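/- Let $\mathcal M=(S,\mathit{Act},P,s_{init})$ be a finite Markov decision process with transition probabilities $P(s,\alpha,t)\in[0,1]\cap\mathbb Q$, where $\sum_{t}P(s,\alpha,t)\in\{0,1\}$ for all $(s,\alpha)$ and the set $\mathit{Act}(s)=\{\alpha : \sum_t P(s,\alpha,t)=1\}$ of enabled actions is non-empty for every $s$. Let $T\subseteq S$ be a set of absorbing states (i.e. $P(q,\alpha,q)=1$ for all $q\in T$, $\alpha\in\mathit{Act}(q)$), and let $\mathit{wgt}\colon T\to\mathbb Q$. For an infinite path $\pi$ put $\mathrm{WR}(\pi)=\mathit{wgt}(q)$ if $\pi$ reaches $q\in T$, and $\mathrm{WR}(\pi)=0$ if $\pi$ does not reach $T$. Schedulers are history-dependent and randomized, $\mathbb V^{\mathfrak S}_{\mathcal M}(\mathrm{WR})$ is the variance of $\mathrm{WR}$ under the path measure induced by the scheduler $\mathfrak S$ from $s_{init}$, and $\mathbb V^{\max}_{\mathcal M}(\mathrm{WR})=\sup_{\mathfrak S}\mathbb V^{\mathfrak S}_{\mathcal M}(\mathrm{WR})$. Assume that under every scheduler $T$ is reached from $s_{init}$ almost surely. Consider the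 following quadratic program in real variables $x_{s,\alpha}$ ($s\in S\setminus T$, $\alpha\in\mathit{Act}(s)$), $y_q$ ($q\in T$), $e_1$, $e_2$: maximize $e_2-e_1^2$ subject to $$x_{s,\alpha}\ge 0\quad (s\in S\setminus T,\ \alpha\in\mathit{Act}(s)),$$ $$\sum_{\alpha\in\mathit{Act}(s)}x_{s,\alpha}=\sum_{t\in S\setminus T}\ \sum_{\beta\in\mathit{Act}(t)}x_{t,\beta}\,P(t,\beta,s)+\mathbb 1_{s=s_{init}}\quad (s\in S\setminus T),$$ $$y_q=\sum_{t\in S\setminus T}\ \sum_{\beta\in\mathit{Act}(t)}x_{t,\beta}\,P(t,\beta,q)\quad (q\in T),$$ $$e_1=\sum_{q\in T}y_q\,\mathit{wgt}(q),\qquad e_2=\sum_{q\in T}y_q\,\mathit{wgt}(q)^2 .$$ The feasible region is convex and the objective is concave on it, the supremum $\mathbb V^{\max}_{\mathcal M}(\mathrm{WR})$ is finite, and the program attains a maximal value, which equals $\mathbb V^{\max}_{\mathcal M}(\mathrm{WR})$. -/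

import Mathlib

open MeasureTheory ProbabilityTheory

/-- A Markov decision process with finite state space `S`, finite set of actions `Act`, rational
transition probabilities and an initial state. The row sums are `0` or `1`, and every state has an
action whose row sum is `1`. -/
structure MDP (S Act : Type*) [Fintype S] where
  P : S → Act → S → ℚ
  init : S
  P_nonneg : ∀ s a t, 0 ≤ P s a t
  P_sum : ∀ s a, ∑ t, P s a t = 0 ∨ ∑ t, P s a t = 1
  exists_enabled : ∀ s, ∃ a, ∑ t, P s a t = 1

/-- A finite alternating sequence `s₀ α₀ s₁ α₁ … α_{k-1} s_k` of states and actions, `k = len`. -/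
structure FinPath (S Act : Type*) where
  len : ℕ
  state : Fin (len + 1) → S
  act : Fin len → Act

/-- Infinite alternating sequences `s₀ α₀ s₁ α₁ …`: the pair of the sequence of states and the
sequence of actions. -/
abbrev InfPath (S Act : Type*) := (ℕ → S) × (ℕ → Act)

namespace FinPath

variable {S Act : Type*}

/-- The last state of a finite path. -/
def last (π : FinPath S Act) : S := π.state (Fin.last π.len)

/-- The finite path that starts in `s` and continues with the given (action, next state) steps. -/
def ofSteps (s : S) {k : ℕ} (w : Fin k → Act × S) : FinPath S Act where
  len := k
  state := Fin.cases s fun i => (w i).2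
  act := fun i => (w i).1

end FinPath

/-- The infinite path that starts in `s` and continues with the given (action, next state) steps. -/
def InfPath.ofSteps {S Act : Type*} (s : S) (w : ℕ → Act × S) : InfPath S Act :=
  (fun n => Nat.casesOn n s fun k => (w k).2, fun n => (w n).1)

namespace MDP

variable {S Act : Type*} [Fintype S] [Fintype Act]

/-- `Act(s)`: the set of actions that are enabled in `s`. -/
def enabled (M : MDP S Act) (s : S) : Finset Act :=
  Finset.univ.filter fun a => ∑ t, M.P s a t = 1

/-- All enabled actions of `s` lead back to `s` with probability one. -/
def IsAbsorbing (M : MDP S Act) (s : S) : Prop :=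
  ∀ a ∈ M.enabled s, M.P s a s = 1

/-- A (history-dependent, randomized) scheduler: it assigns to each finite path a probability
distribution over the actions that are enabled in the last state. For convenience it is also defined
on alternating sequences that contain a transition of probability zero; the values there have no
influence on the path measure. -/
structure Scheduler (M : MDP S Act) where
  choose : FinPath S Act → PMF Act
  enabled_of_mem_support : ∀ π, ∀ a ∈ (choose π).support, a ∈ M.enabled π.last

/-- The distribution of the next pair (action, state) after the finite path `π`:
the pair `(α, t)` has probability `𝔖(π)(α) · P(last π, α, t)`. -/
noncomputable def stepPMF (M : MDP S Act) (𝔖 : M.Scheduler) (π : FinPath S Act) : PMF (Act × S) :=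
  PMF.ofFintype
    (fun p => 𝔖.choose π p.1 * ENNReal.ofReal ((M.P π.last p.1 p.2 : ℚ) : ℝ)) <| by
    have key : ∀ a, ∑ t, 𝔖.choose π a * ENNReal.ofReal ((M.P π.last a t : ℚ) : ℝ)
        = 𝔖.choose π a := by
      intro a
      by_cases ha : a ∈ (𝔖.choose π).support
      · have h1 : ∑ t, M.P π.last a t = 1 := by
          simpa [enabled] using 𝔖.enabled_of_mem_support π a ha
        rw [← Finset.mul_sum, ← ENNReal.ofReal_sum_of_nonneg
          (fun t _ => Rat.cast_nonneg.2 (M.P_nonneg _ _ _)), ← Rat.cast_sum, h1]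
        simp
      · rw [PMF.mem_support_iff, not_not] at ha
        simp [ha]
    rw [Fintype.sum_prod_type]
    simp_rw [key]
    rw [← tsum_fintype (L := SummationFilter.unconditional _)]
    exact (𝔖.choose π).tsum_coe

section Measure

variable [MeasurableSpace S] [MeasurableSingletonClass S]
  [MeasurableSpace Act] [MeasurableSingletonClass Act]

/-- The transition kernel of the step process: from the first `n + 1` steps of a path that starts
in `s` to the next step. -/
noncomputable def stepKernel (M : MDP S Act) (𝔖 : M.Scheduler) (s : S) (n : ℕ) :
    Kernel (∀ _ : Finset.Iic n, Act × S) (Act × S) :=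
  Kernel.ofFunOfCountable fun h =>
    (M.stepPMF 𝔖 (FinPath.ofSteps s fun i : Fin (n + 1) =>
      h ⟨i, Finset.mem_Iic.2 (Nat.lt_succ_iff.1 i.2)⟩)).toMeasure

instance (M : MDP S Act) (𝔖 : M.Scheduler) (s : S) (n : ℕ) :
    IsMarkovKernel (M.stepKernel 𝔖 s n) :=
  ⟨fun _ => PMF.toMeasure.isProbabilityMeasure _⟩

/-- The probability measure on infinite paths induced by the scheduler `𝔖` and the state `s`
(Ionescu-Tulcea): the cylinder of `s₀ α₀ … s_k` with `s₀ = s` has measure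
`∏ i < k, 𝔖(s₀ α₀ … s_i)(α_i) · P(s_i, α_i, s_{i+1})`. -/
noncomputable def pathMeasure (M : MDP S Act) (𝔖 : M.Scheduler) (s : S) :
    Measure (InfPath S Act) :=
  (Kernel.trajMeasure (X := fun _ => Act × S)
    (M.stepPMF 𝔖 (FinPath.ofSteps (k := 0) s Fin.elim0)).toMeasure
    (M.stepKernel 𝔖 s)).map (InfPath.ofSteps s)

/-- `V^max_M(X)`: the supremum over all schedulers of the variance of `X`, from the initial state. -/
noncomputable def maxVariance (M : MDP S Act) (X : InfPath S Act → ℝ) : ℝ :=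
  ⨆ 𝔖 : M.Scheduler, variance X (M.pathMeasure 𝔖 M.init)

end Measure

section Program

variable [DecidableEq S]

/-- The points `(x, y, e₁, e₂)` over which the quadratic program optimizes. Only the coordinates
`x s α` with `s ∉ T` and `α` enabled in `s` occur in the constraints. -/
abbrev ProgramPoint (Act : Type*) (T : Finset S) :=
  (S → Act → ℝ) × (T → ℝ) × ℝ × ℝ

/-- The feasible region of the quadratic program: nonnegativity, flow conservation in the states
outside `T`, the equations that define the reachability variables `y`, and those that define the
expectations `e₁`, `e₂`. -/
def feasible (M : MDP S Act) (T : Finset S) (wgt : T → ℚ) : Set (ProgramPoint Act T) :=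
  {p | match p with
    | (x, y, e₁, e₂) =>
      (∀ s ∉ T, ∀ a ∈ M.enabled s, 0 ≤ x s a) ∧
      (∀ s ∉ T, ∑ a ∈ M.enabled s, x s a =
        (∑ t ∈ Tᶜ, ∑ b ∈ M.enabled t, x t b * (M.P t b s : ℝ)) + if s = M.init then 1 else 0) ∧
      (∀ q : T, y q = ∑ t ∈ Tᶜ, ∑ b ∈ M.enabled t, x t b * (M.P t b q : ℝ)) ∧
      e₁ = ∑ q : T, y q * (wgt q : ℝ) ∧
      e₂ = ∑ q : T, y q * (wgt q : ℝ) ^ 2}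

end Program

/-- The objective function `e₂ - e₁²`. -/
def objective {T : Finset S} (p : ProgramPoint Act T) : ℝ :=
  match p with
  | (_, _, e₁, e₂) => e₂ - e₁ ^ 2

end MDP

open Classical in
/-- Weighted reachability: the weight of the state of `T` that the path reaches, and `0` if it does
not reach `T`. (A path of an MDP in which the states of `T` are absorbing reaches at most one of
them, namely the one it visits first.) -/
noncomputable def WR {S Act : Type*} (T : Finset S) (wgt : T → ℚ) (ω : InfPath S Act) : ℝ :=
  if h : ∃ n, ω.1 n ∈ T then (wgt ⟨ω.1 (Nat.find h), Nat.find_spec h⟩ : ℝ) else 0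

/-! Schedulers and flows are matched through expected visit counts. For a scheduler, let `x s a` be
the expected number of times that action `a` is taken in `s ∉ T`. Summing the one-step equations
over time shows that `x` is a flow and that its inflow to `q ∈ T` is the probability of being
absorbed in `q` (if the initial state is not in `T`). Hence the variance, the second moment minus
the squared mean, is the objective at `x` (`variance_WR_eq_objective`).

The counts are finite because of a potential `L ≥ 0` that drops by at least one in expectation in
every reachable state outside `T` under every enabled action. `exists_potential` gives it on a set
`W ⊇ T` whose complement can be held forever; almost sure absorption keeps the reachable states
inside `W`.

Conversely, a flow `x` yields the memoryless scheduler with action probabilities proportional to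
`x`. On the reachable states, `x` minus the expected visits is a source-free flow whose entries at
each state share a sign, and `L` forces it to vanish (`eq_zero_of_flow`). Unreachable states may
carry a circulation, but it sends nothing to `T`. So both have the same inflow to `T`
(`exists_scheduler_of_isFlow`), and every feasible value is a variance.

The flows need not be bounded, but the expected visits lie in the box `[0, L M.init]`. The objective
has a maximum on the flows in this box, which bounds all variances and is itself one. -/

namespace FinPath

variable {S Act : Type*}

/-- The finite path that starts in `s` and takes the first `n` of the given steps. -/
def prefixOf (s : S) (n : ℕ) (w : ℕ → Act × S) : FinPath S Act :=
  ofSteps s fun i : Fin n => w i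

theorem last_prefixOf (s : S) (n : ℕ) (w : ℕ → Act × S) :
    (prefixOf s n w).last = (InfPath.ofSteps s w).1 n := by
  cases n <;> rfl

end FinPath

/-! ### Measurability of the coordinates of infinite paths -/

theorem InfPath.measurable_ofSteps {S Act : Type*} [MeasurableSpace S] [MeasurableSpace Act] (s : S) :
    Measurable (InfPath.ofSteps (Act := Act) s) := by
  refine Measurable.prodMk (measurable_pi_lambda _ fun n => ?_)
    (measurable_pi_lambda _ fun n => measurable_fst.comp (measurable_pi_apply n))
  cases n with
  | zero => exact measurable_const
  | succ k => exact measurable_snd.comp (measurable_pi_apply k)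

theorem InfPath.measurable_state {S Act : Type*} [MeasurableSpace S] [MeasurableSpace Act]
    (n : ℕ) : Measurable fun ω : InfPath S Act => ω.1 n :=
  (measurable_pi_apply n).comp measurable_fst

theorem InfPath.measurable_act {S Act : Type*} [MeasurableSpace S] [MeasurableSpace Act]
    (n : ℕ) : Measurable fun ω : InfPath S Act => ω.2 n :=
  (measurable_pi_apply n).comp measurable_snd

theorem InfPath.measurableSet_state_eq {S Act : Type*} [MeasurableSpace S]
    [MeasurableSingletonClass S] [MeasurableSpace Act] (n : ℕ) (s : S) :
    MeasurableSet {ω : InfPath S Act | ω.1 n = s} :=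
  InfPath.measurable_state n (measurableSet_singleton s)

/-! ### Markov property, occupation and visit probabilities -/

namespace MDP

open scoped ENNReal

variable {S Act : Type*} [Fintype S] [Fintype Act]

theorem stepPMF_apply (M : MDP S Act) (𝔖 : M.Scheduler) (π : FinPath S Act) (p : Act × S) :
    M.stepPMF 𝔖 π p = 𝔖.choose π p.1 * ENNReal.ofReal ((M.P π.last p.1 p.2 : ℚ) : ℝ) := rfl

theorem mem_enabled {M : MDP S Act} {s : S} {a : Act} :
    a ∈ M.enabled s ↔ ∑ t, M.P s a t = 1 := by
  simp [enabled]

theorem Scheduler.choose_eq_zero {M : MDP S Act} (𝔖 : M.Scheduler) {π : FinPath S Act} {a : Act}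
    (h : a ∉ M.enabled π.last) : 𝔖.choose π a = 0 := by
  by_contra h0
  exact h (𝔖.enabled_of_mem_support π a ((PMF.mem_support_iff _ _).2 h0))

section Measure

variable [MeasurableSpace S] [MeasurableSingletonClass S]
  [MeasurableSpace Act] [MeasurableSingletonClass Act]

/-- The law of the sequence of steps under the scheduler `𝔖`, from the state `s`. -/
noncomputable def stepMeasure (M : MDP S Act) (𝔖 : M.Scheduler) (s : S) :
    Measure (ℕ → Act × S) :=
  Kernel.trajMeasure (X := fun _ => Act × S)
    (M.stepPMF 𝔖 (FinPath.ofSteps (k := 0) s Fin.elim0)).toMeasure (M.stepKernel 𝔖 s)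

instance (M : MDP S Act) (𝔖 : M.Scheduler) (s : S) :
    IsProbabilityMeasure (M.stepMeasure 𝔖 s) := by
  unfold stepMeasure
  infer_instance

theorem pathMeasure_eq (M : MDP S Act) (𝔖 : M.Scheduler) (s : S) :
    M.pathMeasure 𝔖 s = (M.stepMeasure 𝔖 s).map (InfPath.ofSteps s) := rfl

instance (M : MDP S Act) (𝔖 : M.Scheduler) (s : S) :
    IsProbabilityMeasure (M.pathMeasure 𝔖 s) := by
  rw [pathMeasure_eq]
  exact Measure.isProbabilityMeasure_map (InfPath.measurable_ofSteps s).aemeasurable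

theorem lintegral_stepPMF (M : MDP S Act) (𝔖 : M.Scheduler) (π : FinPath S Act)
    (f : Act × S → ℝ≥0∞) :
    ∫⁻ p, f p ∂(M.stepPMF 𝔖 π).toMeasure = ∑ p, M.stepPMF 𝔖 π p * f p := by
  rw [lintegral_fintype]
  refine Finset.sum_congr rfl fun p _ => ?_
  rw [PMF.toMeasure_apply_singleton _ _ (measurableSet_singleton p), mul_comm]

theorem map_zero_stepMeasure (M : MDP S Act) (𝔖 : M.Scheduler) (s : S) :
    (M.stepMeasure 𝔖 s).map (fun w => w 0)
      = (M.stepPMF 𝔖 (FinPath.ofSteps (k := 0) s Fin.elim0)).toMeasure := by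
  have h : (fun w : ℕ → Act × S => w 0)
      = (MeasurableEquiv.piUnique fun _ : Finset.Iic 0 => Act × S) ∘
        Preorder.frestrictLe (π := fun _ : ℕ => Act × S) 0 := rfl
  rw [h, ← Measure.map_map (MeasurableEquiv.measurable _) (by fun_prop), stepMeasure,
    Kernel.trajMeasure, Measure.map_comp _ _ (by fun_prop), Kernel.traj_map_frestrictLe,
    Kernel.partialTraj_self, Measure.id_comp]
  exact MeasurableEquiv.map_apply_eq_iff_map_symm_apply_eq _ |>.2 rfl

/-- The Markov property: conditionally on the first `n` steps, the next step is distributed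
according to `stepPMF`. -/
theorem lintegral_prefixOf_step (M : MDP S Act) (𝔖 : M.Scheduler) (s : S) (n : ℕ)
    (f : FinPath S Act → Act × S → ℝ≥0∞) :
    ∫⁻ w, f (FinPath.prefixOf s n w) (w n) ∂(M.stepMeasure 𝔖 s) =
      ∫⁻ w, ∑ p, M.stepPMF 𝔖 (FinPath.prefixOf s n w) p * f (FinPath.prefixOf s n w) p
        ∂(M.stepMeasure 𝔖 s) := by
  cases n with
  | zero =>
    have hpre : ∀ w : ℕ → Act × S,
        FinPath.prefixOf s 0 w = FinPath.ofSteps (k := 0) s Fin.elim0 := by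
      intro w
      unfold FinPath.prefixOf
      congr 1
      exact Subsingleton.elim _ _
    simp_rw [hpre]
    rw [lintegral_const, measure_univ, mul_one, ← lintegral_stepPMF, ← map_zero_stepMeasure,
      lintegral_map (measurable_of_finite _) (measurable_pi_apply 0)]
  | succ n =>
    let g : (∀ _ : Finset.Iic n, Act × S) → FinPath S Act := fun h =>
      FinPath.ofSteps s fun i : Fin (n + 1) => h ⟨i, Finset.mem_Iic.2 (Nat.lt_succ_iff.1 i.2)⟩
    have hm : Measurable fun q : (∀ _ : Finset.Iic n, Act × S) × (Act × S) => f (g q.1) q.2 :=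
      measurable_of_countable _
    have hl : Measurable (Preorder.frestrictLe (π := fun _ : ℕ => Act × S) n) := by fun_prop
    have key := Kernel.map_frestrictLe_trajMeasure_compProd_eq_map_trajMeasure
      (X := fun _ => Act × S) (κ := M.stepKernel 𝔖 s)
      (μ₀ := (M.stepPMF 𝔖 (FinPath.ofSteps (k := 0) s Fin.elim0)).toMeasure) (a := n)
    have h1 := congrArg (fun m => ∫⁻ q, f (g q.1) q.2 ∂m) key
    beta_reduce at h1
    rw [Measure.lintegral_compProd hm, lintegral_map (measurable_of_countable _) hl,
      lintegral_map hm (by fun_prop)] at h1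
    refine Eq.trans h1.symm (lintegral_congr fun w => ?_)
    exact lintegral_stepPMF M 𝔖 (g _) _


/-- The probability that the path is in state `s` after `n` steps and takes the action `a`. -/
noncomputable def visit (M : MDP S Act) (𝔖 : M.Scheduler) (n : ℕ) (s : S) (a : Act) : ℝ :=
  (M.pathMeasure 𝔖 M.init).real {ω | ω.1 n = s ∧ ω.2 n = a}

/-- The probability that the path is in state `s` after `n` steps. -/
noncomputable def occ (M : MDP S Act) (𝔖 : M.Scheduler) (n : ℕ) (s : S) : ℝ :=
  (M.pathMeasure 𝔖 M.init).real {ω | ω.1 n = s}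

theorem measurableSet_step (n : ℕ) (A : Set (S × Act × S)) :
    MeasurableSet {ω : InfPath S Act | (ω.1 n, ω.2 n, ω.1 (n + 1)) ∈ A} :=
  ((InfPath.measurable_state n).prodMk ((InfPath.measurable_act n).prodMk (InfPath.measurable_state (n + 1))))
    A.toFinite.measurableSet

-- The transition probability depends on the history only through its last state, so it factors out
-- of the integral in the Markov property.
open Classical in
theorem pathMeasure_step (M : MDP S Act) (𝔖 : M.Scheduler) (n : ℕ) (s : S) (a : Act) (t : S) :
    M.pathMeasure 𝔖 M.init {ω | ω.1 n = s ∧ ω.2 n = a ∧ ω.1 (n + 1) = t} =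
      (∫⁻ w, (if (FinPath.prefixOf M.init n w).last = s then
        𝔖.choose (FinPath.prefixOf M.init n w) a else 0) ∂(M.stepMeasure 𝔖 M.init)) *
      ENNReal.ofReal ((M.P s a t : ℚ) : ℝ) := by
  have hms : MeasurableSet {ω : InfPath S Act | ω.1 n = s ∧ ω.2 n = a ∧ ω.1 (n + 1) = t} := by
    convert measurableSet_step n {(s, a, t)} using 1
    ext ω
    simp
  rw [pathMeasure_eq, Measure.map_apply (InfPath.measurable_ofSteps _) hms,
    ← lintegral_indicator_one (InfPath.measurable_ofSteps _ hms),
    ← lintegral_mul_const' _ _ ENNReal.ofReal_ne_top]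
  refine Eq.trans ?_ ((lintegral_prefixOf_step M 𝔖 M.init n
    fun π p => if π.last = s ∧ p = (a, t) then 1 else 0).trans ?_)
  · refine lintegral_congr fun w => ?_
    rw [FinPath.last_prefixOf]
    simp only [Set.indicator_apply, Set.mem_preimage, Set.mem_ofPred_eq, Pi.one_apply]
    congr 1
    simp [InfPath.ofSteps, Prod.ext_iff]
  · refine lintegral_congr fun w => ?_
    by_cases h : (FinPath.prefixOf M.init n w).last = s
    · simp [h, stepPMF_apply]
    · simp [h]

theorem measureReal_eq_sum_fiber {Ω ι : Type*} [MeasurableSpace Ω] (μ : Measure Ω)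
    [IsFiniteMeasure μ] [Fintype ι] (A : Set Ω) (f : Ω → ι)
    (h : ∀ i, MeasurableSet {ω | ω ∈ A ∧ f ω = i}) :
    μ.real A = ∑ i, μ.real {ω | ω ∈ A ∧ f ω = i} := by
  have hA : A = ⋃ i, {ω | ω ∈ A ∧ f ω = i} := by
    ext ω
    simp
  conv_lhs => rw [hA]
  refine measureReal_iUnion_fintype (fun i j hij => ?_) h
  exact Set.disjoint_left.2 fun ω h1 h2 => hij (h1.2.symm.trans h2.2)

theorem lintegral_choose_of_not_enabled (M : MDP S Act) (𝔖 : M.Scheduler) (n : ℕ) (s : S) (a : Act)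
    (h : a ∉ M.enabled s) :
    (∫⁻ w, (open Classical in if (FinPath.prefixOf M.init n w).last = s then
        𝔖.choose (FinPath.prefixOf M.init n w) a else 0) ∂(M.stepMeasure 𝔖 M.init)) = 0 := by
  classical
  rw [lintegral_eq_zero_of_ae_eq_zero]
  refine Filter.Eventually.of_forall fun w => ?_
  by_cases hs : (FinPath.prefixOf M.init n w).last = s
  · simp [hs, 𝔖.choose_eq_zero (hs ▸ h)]
  · simp [hs]

theorem visit_eq_sum (M : MDP S Act) (𝔖 : M.Scheduler) (n : ℕ) (s : S) (a : Act) :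
    M.visit 𝔖 n s a = ∑ t, (M.pathMeasure 𝔖 M.init).real
      {ω | ω.1 n = s ∧ ω.2 n = a ∧ ω.1 (n + 1) = t} := by
  rw [visit, measureReal_eq_sum_fiber _ _ fun ω : InfPath S Act => ω.1 (n + 1)]
  · simp only [Set.mem_ofPred_eq, and_assoc]
  · intro t
    convert measurableSet_step n {(s, a, t)} using 1
    ext ω
    simp [and_assoc]

-- Sum `pathMeasure_step` over the successor: the row of an enabled action sums to one, and for a
-- disabled action the integral is already zero.
open Classical in
theorem visit_eq_lintegral (M : MDP S Act) (𝔖 : M.Scheduler) (n : ℕ) (s : S) (a : Act) :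
    M.visit 𝔖 n s a =
      (∫⁻ w, (if (FinPath.prefixOf M.init n w).last = s then
        𝔖.choose (FinPath.prefixOf M.init n w) a else 0) ∂(M.stepMeasure 𝔖 M.init)).toReal := by
  simp only [visit_eq_sum, Measure.real, pathMeasure_step, ENNReal.toReal_mul]
  by_cases h : a ∈ M.enabled s
  · rw [← Finset.mul_sum]
    have : ∑ t, (ENNReal.ofReal ((M.P s a t : ℚ) : ℝ)).toReal = 1 := by
      simp_rw [ENNReal.toReal_ofReal (Rat.cast_nonneg.2 (M.P_nonneg _ _ _))]
      exact_mod_cast mem_enabled.1 h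
    rw [this, mul_one]
  · simp [lintegral_choose_of_not_enabled M 𝔖 n s a h]

theorem measureReal_step (M : MDP S Act) (𝔖 : M.Scheduler) (n : ℕ) (s : S) (a : Act) (t : S) :
    (M.pathMeasure 𝔖 M.init).real {ω | ω.1 n = s ∧ ω.2 n = a ∧ ω.1 (n + 1) = t} =
      M.visit 𝔖 n s a * M.P s a t := by
  rw [visit_eq_lintegral, Measure.real, pathMeasure_step, ENNReal.toReal_mul,
    ENNReal.toReal_ofReal (Rat.cast_nonneg.2 (M.P_nonneg _ _ _))]

theorem visit_nonneg (M : MDP S Act) (𝔖 : M.Scheduler) (n : ℕ) (s : S) (a : Act) :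
    0 ≤ M.visit 𝔖 n s a := measureReal_nonneg

theorem occ_nonneg (M : MDP S Act) (𝔖 : M.Scheduler) (n : ℕ) (s : S) :
    0 ≤ M.occ 𝔖 n s := measureReal_nonneg

theorem visit_of_not_enabled (M : MDP S Act) (𝔖 : M.Scheduler) (n : ℕ) {s : S} {a : Act}
    (h : a ∉ M.enabled s) : M.visit 𝔖 n s a = 0 := by
  rw [visit_eq_lintegral, lintegral_choose_of_not_enabled M 𝔖 n s a h, ENNReal.toReal_zero]

theorem sum_visit (M : MDP S Act) (𝔖 : M.Scheduler) (n : ℕ) (s : S) :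
    ∑ a ∈ M.enabled s, M.visit 𝔖 n s a = M.occ 𝔖 n s := by
  rw [Finset.sum_subset (Finset.subset_univ _) fun a _ h => visit_of_not_enabled M 𝔖 n h, occ,
    measureReal_eq_sum_fiber _ _ fun ω : InfPath S Act => ω.2 n]
  · rfl
  · intro a
    simpa using measurableSet_step n {p : S × Act × S | p.1 = s ∧ p.2.1 = a}

theorem occ_succ (M : MDP S Act) (𝔖 : M.Scheduler) (n : ℕ) (t : S) :
    M.occ 𝔖 (n + 1) t = ∑ s, ∑ a ∈ M.enabled s, M.visit 𝔖 n s a * M.P s a t := by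
  rw [occ, measureReal_eq_sum_fiber _ _ fun ω : InfPath S Act => ω.1 n]
  · refine Finset.sum_congr rfl fun s _ => ?_
    rw [Finset.sum_subset (Finset.subset_univ _)
      fun a _ h => by rw [visit_of_not_enabled M 𝔖 n h, zero_mul],
      measureReal_eq_sum_fiber _ _ fun ω : InfPath S Act => ω.2 n]
    · refine Finset.sum_congr rfl fun a _ => ?_
      rw [← measureReal_step]
      congr 1
      ext ω
      simp only [Set.mem_ofPred_eq]
      tauto
    · intro a
      simpa using measurableSet_step n {p : S × Act × S | (p.2.2 = t ∧ p.1 = s) ∧ p.2.1 = a}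
  · intro s
    simpa using measurableSet_step n {p : S × Act × S | p.2.2 = t ∧ p.1 = s}

theorem occ_zero [DecidableEq S] (M : MDP S Act) (𝔖 : M.Scheduler) (s : S) :
    M.occ 𝔖 0 s = if s = M.init then 1 else 0 := by
  rw [occ, pathMeasure_eq, map_measureReal_apply (InfPath.measurable_ofSteps _)
    (InfPath.measurableSet_state_eq 0 s)]
  by_cases h : s = M.init
  · rw [if_pos h]
    convert probReal_univ (μ := M.stepMeasure 𝔖 M.init)
    ext w
    simp [InfPath.ofSteps, h]
  · rw [if_neg h]
    convert measureReal_empty (μ := M.stepMeasure 𝔖 M.init)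
    ext w
    simpa [InfPath.ofSteps] using Ne.symm h

theorem sum_occ (M : MDP S Act) (𝔖 : M.Scheduler) (n : ℕ) : ∑ s, M.occ 𝔖 n s = 1 := by
  rw [← probReal_univ (μ := M.pathMeasure 𝔖 M.init),
    measureReal_eq_sum_fiber _ _ fun ω : InfPath S Act => ω.1 n]
  · simp [occ]
  · intro s
    simpa using InfPath.measurableSet_state_eq n s

theorem visit_eq_zero_of_occ (M : MDP S Act) (𝔖 : M.Scheduler) {n : ℕ} {s : S}
    (h : M.occ 𝔖 n s = 0) (a : Act) : M.visit 𝔖 n s a = 0 := by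
  by_cases ha : a ∈ M.enabled s
  · rw [← sum_visit, Finset.sum_eq_zero_iff_of_nonneg fun a _ => visit_nonneg M 𝔖 n s a] at h
    exact h a ha
  · exact visit_of_not_enabled M 𝔖 n ha

theorem visit_le_occ (M : MDP S Act) (𝔖 : M.Scheduler) (n : ℕ) (s : S) (a : Act) :
    M.visit 𝔖 n s a ≤ M.occ 𝔖 n s :=
  measureReal_mono fun _ h => h.1

/-- The memoryless scheduler that chooses the action in state `s` according to `σ s`. -/
noncomputable def memoryless (M : MDP S Act) (σ : S → PMF Act)
    (h : ∀ s, ∀ a ∈ (σ s).support, a ∈ M.enabled s) : M.Scheduler where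
  choose π := σ π.last
  enabled_of_mem_support π := h π.last

/-- On the event of being in `s` the action probability is the constant `σ s a`, which leaves the
integral. -/
theorem visit_memoryless (M : MDP S Act) (σ : S → PMF Act)
    (h : ∀ s, ∀ a ∈ (σ s).support, a ∈ M.enabled s) (n : ℕ) (s : S) (a : Act) :
    M.visit (M.memoryless σ h) n s a = M.occ (M.memoryless σ h) n s * (σ s a).toReal := by
  classical
  rw [visit_eq_lintegral, occ, Measure.real, pathMeasure_eq, Measure.map_apply
    (InfPath.measurable_ofSteps _) (InfPath.measurableSet_state_eq n s), ← ENNReal.toReal_mul,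
    ← lintegral_indicator_one (InfPath.measurable_ofSteps _ (InfPath.measurableSet_state_eq n s)),
    ← lintegral_mul_const' _ _ (PMF.apply_ne_top _ _)]
  congr 1
  refine lintegral_congr fun w => ?_
  rw [FinPath.last_prefixOf]
  by_cases hs : (InfPath.ofSteps M.init w).1 n = s
  · simp [hs, memoryless, FinPath.last_prefixOf]
  · simp [hs]

end Measure
end MDP

/-! ### Moments of the weighted reachability as limits of occupation sums -/

namespace MDP

open Filter Topology

variable {S Act : Type*} [Fintype S] [Fintype Act]
  [MeasurableSpace S] [MeasurableSingletonClass S]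
  [MeasurableSpace Act] [MeasurableSingletonClass Act]

theorem prob_eq_zero_of_isAbsorbing {S Act : Type*} [Fintype S] [Fintype Act] {M : MDP S Act}
    {s : S} (hs : M.IsAbsorbing s) {a : Act}
    (ha : a ∈ M.enabled s) {t : S} (hts : t ≠ s) : M.P s a t = 0 := by
  classical
  have h1 := mem_enabled.1 ha
  rw [← Finset.add_sum_erase _ _ (Finset.mem_univ s), hs a ha, add_eq_left,
    Finset.sum_eq_zero_iff_of_nonneg fun t _ => M.P_nonneg _ _ _] at h1
  exact h1 t (by simp [hts])

/-- At each time, leaving a state of `T` is a finite union of one-step events, each of probability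
zero. -/
theorem ae_stays_in_absorbing (M : MDP S Act) (𝔖 : M.Scheduler) {T : Finset S}
    (hT : ∀ t ∈ T, M.IsAbsorbing t) :
    ∀ᵐ ω ∂(M.pathMeasure 𝔖 M.init), ∀ n, ω.1 n ∈ T → ω.1 (n + 1) = ω.1 n := by
  rw [ae_all_iff]
  intro n
  have key : ∀ s a t, s ∈ T → t ≠ s → ∀ᵐ ω ∂(M.pathMeasure 𝔖 M.init),
      ¬ (ω.1 n = s ∧ ω.2 n = a ∧ ω.1 (n + 1) = t) := by
    intro s a t hs hts
    rw [ae_iff]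
    simp only [not_not]
    rw [← measureReal_eq_zero_iff, measureReal_step]
    by_cases ha : a ∈ M.enabled s
    · rw [prob_eq_zero_of_isAbsorbing (hT s hs) ha hts, Rat.cast_zero, mul_zero]
    · rw [visit_of_not_enabled M 𝔖 n ha, zero_mul]
  filter_upwards [ae_all_iff.2 fun s => ae_all_iff.2 fun a => ae_all_iff.2 fun t =>
    ae_all_iff.2 fun hs => ae_all_iff.2 fun hts => key s a t hs hts] with ω h hω
  by_contra hne
  exact h (ω.1 n) (ω.2 n) (ω.1 (n + 1)) hω hne ⟨rfl, rfl, rfl⟩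

/-- The contribution of the paths that are in `T` after `n` steps to the `j`-th moment. -/
noncomputable def momentAt {S Act : Type*} (T : Finset S) (wgt : T → ℚ) (j n : ℕ) (ω : InfPath S Act) : ℝ :=
  ∑ q : T, {ω : InfPath S Act | ω.1 n = q}.indicator (fun _ => (wgt q : ℝ) ^ j) ω

theorem measurable_momentAt {S Act : Type*} [MeasurableSpace S] [MeasurableSingletonClass S]
    [MeasurableSpace Act] (T : Finset S) (wgt : T → ℚ) (j n : ℕ) :
    Measurable (momentAt (Act := Act) T wgt j n) :=
  Finset.measurable_sum _ fun q _ =>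
    measurable_const.indicator (InfPath.measurableSet_state_eq n (q : S))

theorem norm_momentAt_le {S Act : Type*} (T : Finset S) (wgt : T → ℚ) (j n : ℕ)
    (ω : InfPath S Act) :
    ‖momentAt T wgt j n ω‖ ≤ ∑ q : T, |(wgt q : ℝ) ^ j| := by
  refine (Finset.abs_sum_le_sum_abs _ _).trans (Finset.sum_le_sum fun q _ => ?_)
  exact norm_indicator_le_norm_self (fun _ => (wgt q : ℝ) ^ j) ω

theorem integral_momentAt (M : MDP S Act) (𝔖 : M.Scheduler) (T : Finset S) (wgt : T → ℚ)
    (j n : ℕ) : ∫ ω, momentAt T wgt j n ω ∂(M.pathMeasure 𝔖 M.init)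
      = ∑ q : T, M.occ 𝔖 n q * (wgt q : ℝ) ^ j := by
  unfold momentAt
  rw [integral_finsetSum]
  · refine Finset.sum_congr rfl fun q _ => ?_
    rw [integral_indicator_const _ (InfPath.measurableSet_state_eq n (q : S)), smul_eq_mul, occ]
  · exact fun q _ => (integrable_const _).indicator (InfPath.measurableSet_state_eq n (q : S))

/-- From the first visit to `T` on, the path almost surely stays put, so the sequence is eventually
constant. -/
theorem tendsto_momentAt (M : MDP S Act) (𝔖 : M.Scheduler) {T : Finset S}
    (hT : ∀ t ∈ T, M.IsAbsorbing t)
    (hreach : ∀ᵐ ω ∂(M.pathMeasure 𝔖 M.init), ∃ n, ω.1 n ∈ T) (wgt : T → ℚ) (j : ℕ) :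
    ∀ᵐ ω ∂(M.pathMeasure 𝔖 M.init),
      Tendsto (fun n => momentAt T wgt j n ω) atTop (𝓝 (WR T wgt ω ^ j)) := by
  classical
  filter_upwards [hreach, M.ae_stays_in_absorbing 𝔖 hT] with ω h hstay
  refine tendsto_const_nhds.congr' ?_
  filter_upwards [eventually_ge_atTop (Nat.find h)] with n hn
  have hconst : ω.1 n = ω.1 (Nat.find h) := by
    induction n, hn using Nat.le_induction with
    | base => rfl
    | succ n hn ih => rw [hstay n (ih ▸ Nat.find_spec h), ih]
  rw [WR, dif_pos h, momentAt, Finset.sum_eq_single ⟨ω.1 (Nat.find h), Nat.find_spec h⟩]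
  · rw [Set.indicator_of_mem (by exact hconst)]
  · intro q _ hq
    refine Set.indicator_of_notMem (fun hq' => hq (Subtype.ext ?_)) _
    exact Eq.trans (Eq.symm hq') hconst
  · exact fun h => absurd (Finset.mem_univ _) h

theorem tendsto_sum_occ (M : MDP S Act) (𝔖 : M.Scheduler) {T : Finset S}
    (hT : ∀ t ∈ T, M.IsAbsorbing t)
    (hreach : ∀ᵐ ω ∂(M.pathMeasure 𝔖 M.init), ∃ n, ω.1 n ∈ T) (wgt : T → ℚ) (j : ℕ) :
    Tendsto (fun n => ∑ q : T, M.occ 𝔖 n q * (wgt q : ℝ) ^ j) atTop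
      (𝓝 (∫ ω, WR T wgt ω ^ j ∂(M.pathMeasure 𝔖 M.init))) := by
  simp_rw [← integral_momentAt]
  exact tendsto_integral_of_dominated_convergence _
    (fun n => (measurable_momentAt T wgt j n).aestronglyMeasurable) (integrable_const _)
    (fun n => Eventually.of_forall (norm_momentAt_le T wgt j n))
    (tendsto_momentAt M 𝔖 hT hreach wgt j)

/-- Measurability of `WR` up to null sets and its boundedness are both inherited from the almost
sure limit of `momentAt`. -/
theorem variance_WR (M : MDP S Act) (𝔖 : M.Scheduler) {T : Finset S}
    (hT : ∀ t ∈ T, M.IsAbsorbing t)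
    (hreach : ∀ᵐ ω ∂(M.pathMeasure 𝔖 M.init), ∃ n, ω.1 n ∈ T) (wgt : T → ℚ) :
    variance (WR T wgt) (M.pathMeasure 𝔖 M.init) =
      ∫ ω, WR T wgt ω ^ 2 ∂(M.pathMeasure 𝔖 M.init)
        - (∫ ω, WR T wgt ω ^ 1 ∂(M.pathMeasure 𝔖 M.init)) ^ 2 := by
  have hlim := tendsto_momentAt M 𝔖 hT hreach wgt 1
  have hm : AEStronglyMeasurable (WR T wgt) (M.pathMeasure 𝔖 M.init) :=
    aestronglyMeasurable_of_tendsto_ae atTop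
      (fun n => (measurable_momentAt T wgt 1 n).aestronglyMeasurable)
      (by simpa only [pow_one] using hlim)
  have hb : ∀ᵐ ω ∂(M.pathMeasure 𝔖 M.init), ‖WR T wgt ω‖ ≤ ∑ q : T, |(wgt q : ℝ) ^ 1| := by
    filter_upwards [hlim] with ω hω
    rw [pow_one] at hω
    exact le_of_tendsto hω.norm (Eventually.of_forall fun n => norm_momentAt_le T wgt 1 n ω)
  rw [variance_eq_sub (MemLp.of_bound hm _ hb)]
  simp only [pow_one, Pi.pow_apply]

end MDP

/-! ### A potential, and reachability of `T` -/

namespace MDP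

open Filter Topology

theorem exists_potential_aux {S Act : Type*} [Fintype S] [Fintype Act] (M : MDP S Act)
    (T : Finset S) : ∃ W : Set S, (∀ s ∈ T, s ∈ W) ∧
      (∃ ℓ : S → ℝ, (∀ s, 0 ≤ ℓ s) ∧ (∀ s, ℓ s ≤ 1) ∧ (∀ s ∈ W, ℓ s < 1) ∧ (∀ s ∉ W, ℓ s = 1) ∧
        ∀ s ∈ W, s ∉ T → ∀ a ∈ M.enabled s, ∑ t, (M.P s a t : ℝ) * ℓ t < ℓ s) ∧
      ∀ s ∉ W, ∃ a ∈ M.enabled s, ∀ t ∈ W, M.P s a t = 0 := by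
  classical
  let good : Set (Set S) := {W | (∀ s ∈ T, s ∈ W) ∧
      (∃ ℓ : S → ℝ, (∀ s, 0 ≤ ℓ s) ∧ (∀ s, ℓ s ≤ 1) ∧ (∀ s ∈ W, ℓ s < 1) ∧ (∀ s ∉ W, ℓ s = 1) ∧
        ∀ s ∈ W, s ∉ T → ∀ a ∈ M.enabled s, ∑ t, (M.P s a t : ℝ) * ℓ t < ℓ s)}
  have hne : good.Nonempty := by
    refine ⟨{s | s ∈ T}, fun s hs => hs, fun s => if s ∈ T then 0 else 1, ?_, ?_, ?_, ?_, ?_⟩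
    · intro s; dsimp only; split_ifs <;> norm_num
    · intro s; dsimp only; split_ifs <;> norm_num
    · intro s hs; simp only [if_pos (show s ∈ T from hs)]; norm_num
    · exact fun s hs => if_neg hs
    · exact fun s hs hs' => absurd hs hs'
  obtain ⟨W, hW⟩ := good.toFinite.exists_maximal hne
  refine ⟨W, hW.prop.1, hW.prop.2, fun s hs => ?_⟩
  by_contra! hbad
  obtain ⟨hTW, ℓ, h0, h1, hlt, heq, hdec⟩ := hW.prop
  have hPℓ : ∀ a ∈ M.enabled s, ∑ t, (M.P s a t : ℝ) * ℓ t < 1 := by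
    intro a ha
    obtain ⟨t, ht, hPt⟩ := hbad a ha
    have hsum : ∑ t, (M.P s a t : ℝ) = 1 := by exact_mod_cast mem_enabled.1 ha
    rw [← hsum]
    have hnn : ∀ t, (0 : ℝ) ≤ M.P s a t := fun t => Rat.cast_nonneg.2 (M.P_nonneg _ _ _)
    refine Finset.sum_lt_sum (fun u _ => mul_le_of_le_one_right (hnn u) (h1 u))
      ⟨t, Finset.mem_univ _, ?_⟩
    have : (0 : ℝ) < M.P s a t := lt_of_le_of_ne (hnn t) (by exact_mod_cast hPt.symm)
    nlinarith [hlt t ht]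
  have hen : (M.enabled s).Nonempty :=
    let ⟨a, ha⟩ := M.exists_enabled s
    ⟨a, mem_enabled.2 ha⟩
  obtain ⟨a₀, ha₀, hmax⟩ := (M.enabled s).exists_max_image
    (fun a => ∑ t, (M.P s a t : ℝ) * ℓ t) hen
  -- The new value at `s` lies above the expectation under every action and below the old value one.
  -- Lowering `ℓ` only decreases expectations, so the inequalities at the old states of `W` survive.
  obtain ⟨c, hc, hc1⟩ := exists_between (hPℓ a₀ ha₀)
  have hc0 : 0 ≤ c := (Finset.sum_nonneg fun t _ =>
    mul_nonneg (Rat.cast_nonneg.2 (M.P_nonneg _ _ _)) (h0 t)).trans hc.le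
  have hle : ∀ t, Function.update ℓ s c t ≤ ℓ t := by
    intro t
    by_cases h : t = s
    · rw [h, Function.update_self, heq s hs]; exact hc1.le
    · rw [Function.update_of_ne h]
  have hPle : ∀ u a, ∑ t, (M.P u a t : ℝ) * Function.update ℓ s c t
      ≤ ∑ t, (M.P u a t : ℝ) * ℓ t := fun u a => Finset.sum_le_sum fun t _ =>
    mul_le_mul_of_nonneg_left (hle t) (Rat.cast_nonneg.2 (M.P_nonneg _ _ _))
  have hgood : insert s W ∈ good := by
    refine ⟨fun t ht => Set.mem_insert_of_mem _ (hTW t ht), Function.update ℓ s c, ?_,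
      fun t => (hle t).trans (h1 t), ?_, ?_, ?_⟩
    · intro t
      by_cases h : t = s
      · rw [h, Function.update_self]; exact hc0
      · rw [Function.update_of_ne h]; exact h0 t
    · rintro t (rfl | ht)
      · rwa [Function.update_self]
      · exact (hle t).trans_lt (hlt t ht)
    · intro t ht
      rw [Set.mem_insert_iff, not_or] at ht
      rw [Function.update_of_ne ht.1, heq t ht.2]
    · rintro t (rfl | ht) htT a ha
      · rw [Function.update_self]
        exact (hPle t a).trans_lt ((hmax a ha).trans_lt hc)
      · rw [Function.update_of_ne (show t ≠ s from fun h => hs (h ▸ ht))]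
        exact (hPle t a).trans_lt (hdec t ht htT a ha)
  exact hs (hW.le_of_ge hgood (Set.subset_insert _ _) (Set.mem_insert _ _))

/-- There are a set `W ⊇ T` and a function that decreases by at least one in expectation in every
step from `W \ T`, such that in every state outside `W` some action avoids `W`. -/
theorem exists_potential {S Act : Type*} [Fintype S] [Fintype Act] (M : MDP S Act)
    (T : Finset S) : ∃ (W : Set S) (L : S → ℝ), (∀ s ∈ T, s ∈ W) ∧ (∀ s, 0 ≤ L s) ∧
      (∀ s ∈ W, s ∉ T → ∀ a ∈ M.enabled s, ∑ t, (M.P s a t : ℝ) * L t + 1 ≤ L s) ∧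
      ∀ s ∉ W, ∃ a ∈ M.enabled s, ∀ t ∈ W, M.P s a t = 0 := by
  obtain ⟨W, hTW, ⟨ℓ, h0, -, -, -, hdec⟩, hW⟩ := exists_potential_aux M T
  -- Finitely many strict decreases have a positive minimum `δ`; dividing `ℓ` by it makes each of
  -- them at least one.
  let I : Set (S × Act) := {p | p.1 ∈ W ∧ p.1 ∉ T ∧ p.2 ∈ M.enabled p.1}
  let gap : S × Act → ℝ := fun p => ℓ p.1 - ∑ t, (M.P p.1 p.2 t : ℝ) * ℓ t
  obtain ⟨δ, hδ, hgap⟩ : ∃ δ : ℝ, 0 < δ ∧ ∀ p ∈ I, δ ≤ gap p := by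
    rcases I.eq_empty_or_nonempty with hI | hI
    · exact ⟨1, one_pos, by simp [hI]⟩
    · obtain ⟨p, hp, hmin⟩ := Set.exists_min_image I gap I.toFinite hI
      exact ⟨gap p, sub_pos.2 (hdec p.1 hp.1 hp.2.1 p.2 hp.2.2), hmin⟩
  refine ⟨W, fun s => ℓ s / δ, hTW, fun s => div_nonneg (h0 s) hδ.le, ?_, hW⟩
  intro s hs hsT a ha
  have h := hgap (s, a) ⟨hs, hsT, ha⟩
  simp only [gap] at h
  simp_rw [← mul_div_assoc]
  rw [← Finset.sum_div, ← div_self hδ.ne', ← add_div]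
  exact div_le_div_of_nonneg_right (by linarith) hδ.le

variable {S Act : Type*} [Fintype S] [Fintype Act]
  [MeasurableSpace S] [MeasurableSingletonClass S]
  [MeasurableSpace Act] [MeasurableSingletonClass Act]

theorem le_occ_succ (M : MDP S Act) (𝔖 : M.Scheduler) (n : ℕ) {s : S} {a : Act}
    (ha : a ∈ M.enabled s) (t : S) : M.visit 𝔖 n s a * M.P s a t ≤ M.occ 𝔖 (n + 1) t := by
  have hnn : ∀ s a, 0 ≤ M.visit 𝔖 n s a * M.P s a t := fun s a =>
    mul_nonneg (visit_nonneg M 𝔖 n s a) (Rat.cast_nonneg.2 (M.P_nonneg _ _ _))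
  rw [occ_succ]
  exact (Finset.single_le_sum (f := fun a => M.visit 𝔖 n s a * M.P s a t)
    (fun a _ => hnn s a) ha).trans
    (Finset.single_le_sum (f := fun s => ∑ a ∈ M.enabled s, M.visit 𝔖 n s a * M.P s a t)
      (fun s _ => Finset.sum_nonneg fun a _ => hnn s a) (Finset.mem_univ s))

/-- The states that are reachable from the initial state. -/
def reachable {S Act : Type*} [Fintype S] [Fintype Act] (M : MDP S Act) : Set S :=
  {s | Relation.ReflTransGen (fun s t => ∃ a ∈ M.enabled s, M.P s a t ≠ 0) M.init s}

/-- If every scheduler reaches `T` almost surely, then no reachable state belongs to a set outside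
of `T` in which a scheduler can stay forever. -/
theorem reachable_subset_of_ae_reach (M : MDP S Act) {T : Finset S}
    (hT : ∀ t ∈ T, M.IsAbsorbing t)
    (hreach : ∀ 𝔖 : M.Scheduler, ∀ᵐ ω ∂(M.pathMeasure 𝔖 M.init), ∃ n, ω.1 n ∈ T)
    {W : Set S} (hTW : ∀ s ∈ T, s ∈ W)
    (hW : ∀ s ∉ W, ∃ a ∈ M.enabled s, ∀ t ∈ W, M.P s a t = 0) : M.reachable ⊆ W := by
  classical
  have hen : ∀ s, (M.enabled s).Nonempty := fun s =>
    let ⟨a, ha⟩ := M.exists_enabled s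
    ⟨a, mem_enabled.2 ha⟩
  have : Nonempty Act := (hen M.init).to_type
  choose! b hb hbW using hW
  -- Inside `W` all enabled actions are tried, so everything reachable is visited unless the path
  -- leaves `W` first; outside `W` the chosen action never returns.
  let σ : S → PMF Act := fun s =>
    if s ∈ W then PMF.uniformOfFinset (M.enabled s) (hen s) else PMF.pure (b s)
  have hσ : ∀ s, ∀ a ∈ (σ s).support, a ∈ M.enabled s := by
    intro s a ha
    by_cases hs : s ∈ W
    · simpa [σ, hs] using ha
    · have : a = b s := by simpa [σ, hs] using ha
      exact this ▸ hb s hs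
  let 𝔖 := M.memoryless σ hσ
  have hbase : ∀ s, s ∈ M.reachable → (∃ n, 0 < M.occ 𝔖 n s) ∨ ∃ u ∉ W, ∃ n, 0 < M.occ 𝔖 n u := by
    intro s hs
    induction hs with
    | refl => exact Or.inl ⟨0, by simp [occ_zero]⟩
    | @tail s t _ hst ih =>
      rcases ih with ⟨n, hn⟩ | ih
      · by_cases hsW : s ∈ W
        · obtain ⟨a, ha, hP⟩ := hst
          refine Or.inl ⟨n + 1, lt_of_lt_of_le ?_ (M.le_occ_succ 𝔖 n ha t)⟩
          rw [visit_memoryless]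
          have h1 : 0 < (σ s a).toReal := by
            refine ENNReal.toReal_pos ?_ (PMF.apply_ne_top _ _)
            rw [← PMF.mem_support_iff]
            simpa [σ, hsW] using ha
          have h2 : (0 : ℝ) < M.P s a t :=
            Rat.cast_pos.2 (lt_of_le_of_ne (M.P_nonneg _ _ _) hP.symm)
          exact mul_pos (mul_pos hn h1) h2
        · exact Or.inr ⟨s, hsW, n, hn⟩
      · exact Or.inr ih
  intro s hs
  by_contra hsW
  obtain ⟨u, hu, n, hn⟩ : ∃ u ∉ W, ∃ n, 0 < M.occ 𝔖 n u :=
    (hbase s hs).elim (fun h => ⟨s, hsW, h⟩) id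
  let out : Finset S := Finset.univ.filter (· ∉ W)
  have hvisit : ∀ n, ∀ s ∉ W, M.visit 𝔖 n s (b s) = M.occ 𝔖 n s := by
    intro n s hs
    rw [visit_memoryless]
    simp [σ, hs, 𝔖]
  have hPout : ∀ s ∉ W, ∑ t ∈ out, (M.P s (b s) t : ℝ) = 1 := by
    intro s hs
    rw [Finset.sum_subset (Finset.subset_univ _)]
    · exact_mod_cast mem_enabled.1 (hb s hs)
    · intro t _ ht
      rw [hbW s hs t (by simpa [out] using ht), Rat.cast_zero]
  -- The mass outside `W` never decreases, since there all of it moves along `b` to states outside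
  -- `W`.
  have hstep : ∀ n, ∑ s ∈ out, M.occ 𝔖 n s ≤ ∑ s ∈ out, M.occ 𝔖 (n + 1) s := by
    intro n
    have hnn : ∀ s a t, 0 ≤ M.visit 𝔖 n s a * M.P s a t := fun s a t =>
      mul_nonneg (visit_nonneg M 𝔖 n s a) (Rat.cast_nonneg.2 (M.P_nonneg _ _ _))
    calc ∑ s ∈ out, M.occ 𝔖 n s
        = ∑ s ∈ out, ∑ t ∈ out, M.visit 𝔖 n s (b s) * M.P s (b s) t := by
          refine Finset.sum_congr rfl fun s hs => ?_
          have hs' : s ∉ W := by simpa [out] using hs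
          rw [← Finset.mul_sum, hPout s hs', mul_one, hvisit n s hs']
      _ = ∑ t ∈ out, ∑ s ∈ out, M.visit 𝔖 n s (b s) * M.P s (b s) t := Finset.sum_comm
      _ ≤ ∑ t ∈ out, M.occ 𝔖 (n + 1) t := by
          refine Finset.sum_le_sum fun t _ => ?_
          rw [occ_succ]
          refine (Finset.sum_le_sum fun s hs => ?_).trans
            (Finset.sum_le_sum_of_subset_of_nonneg (Finset.subset_univ out)
              fun s _ _ => Finset.sum_nonneg fun a _ => hnn s a t)
          exact Finset.single_le_sum (f := fun a => M.visit 𝔖 n s a * M.P s a t)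
            (fun a _ => hnn s a t) (hb s (by simpa [out] using hs))
  have hmono : Monotone fun n => ∑ s ∈ out, M.occ 𝔖 n s := monotone_nat_of_le_succ hstep
  -- With exponent `0` the moment is one whatever the weight, so the mass in `T` tends to one; the
  -- positive mass trapped outside `W` contradicts this.
  have hlim := tendsto_sum_occ M 𝔖 hT (hreach 𝔖) (fun _ => 0) 0
  simp only [pow_zero, mul_one, integral_const, probReal_univ, smul_eq_mul] at hlim
  have hle : ∀ m ≥ n, ∑ q : T, M.occ 𝔖 m q ≤ 1 - M.occ 𝔖 n u := by
    intro m hm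
    have h1 : M.occ 𝔖 n u ≤ ∑ s ∈ out, M.occ 𝔖 n s :=
      Finset.single_le_sum (fun s _ => occ_nonneg M 𝔖 n s) (by simp [out, hu])
    have h2 : ∑ s ∈ T ∪ out, M.occ 𝔖 m s ≤ ∑ s, M.occ 𝔖 m s :=
      Finset.sum_le_sum_of_subset_of_nonneg (Finset.subset_univ _)
        fun s _ _ => occ_nonneg M 𝔖 m s
    rw [Finset.sum_union (Finset.disjoint_left.2 fun s hs => by simp [out, hTW s hs]),
      sum_occ] at h2
    rw [Finset.sum_coe_sort T (M.occ 𝔖 m)]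
    linarith [hmono hm]
  have := le_of_tendsto hlim (eventually_atTop.2 ⟨n, hle⟩)
  linarith

theorem occ_eq_zero_of_not_reachable (M : MDP S Act) (𝔖 : M.Scheduler) (n : ℕ) {s : S}
    (hs : s ∉ M.reachable) : M.occ 𝔖 n s = 0 := by
  classical
  induction n generalizing s with
  | zero =>
    rw [occ_zero, if_neg]
    rintro rfl
    exact hs Relation.ReflTransGen.refl
  | succ n ih =>
    rw [occ_succ]
    refine Finset.sum_eq_zero fun t _ => Finset.sum_eq_zero fun a ha => ?_
    by_cases ht : t ∈ M.reachable
    · by_cases hP : M.P t a s = 0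
      · rw [hP, Rat.cast_zero, mul_zero]
      · exact absurd (Relation.ReflTransGen.tail ht ⟨a, ha, hP⟩) hs
    · have h0 := M.sum_visit 𝔖 n t
      rw [ih ht, Finset.sum_eq_zero_iff_of_nonneg fun a _ => visit_nonneg M 𝔖 n t a] at h0
      rw [h0 a ha, zero_mul]

end MDP

/-! ### Flows and the geometry of the program -/

namespace MDP

open Filter Topology

section Flow

variable {S Act : Type*} [Fintype S] [Fintype Act] [DecidableEq S]

/-- The flow that the transitions from the states outside `T` send into the state `s`. -/
noncomputable def inflow (M : MDP S Act) (T : Finset S) (x : S → Act → ℝ) (s : S) : ℝ :=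
  ∑ t ∈ Tᶜ, ∑ b ∈ M.enabled t, x t b * (M.P t b s : ℝ)

/-- Nonnegativity and flow conservation in the states outside `T`. -/
def IsFlow (M : MDP S Act) (T : Finset S) (x : S → Act → ℝ) : Prop :=
  (∀ s ∉ T, ∀ a ∈ M.enabled s, 0 ≤ x s a) ∧
  ∀ s ∉ T, ∑ a ∈ M.enabled s, x s a = M.inflow T x s + if s = M.init then 1 else 0

/-- The point of the quadratic program that is determined by its flow variables. -/
noncomputable def ofFlow (M : MDP S Act) (T : Finset S) (wgt : T → ℚ) (x : S → Act → ℝ) :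
    ProgramPoint Act T :=
  (x, fun q => M.inflow T x q, ∑ q : T, M.inflow T x q * (wgt q : ℝ),
    ∑ q : T, M.inflow T x q * (wgt q : ℝ) ^ 2)

/-- The other coordinates are functions of `x`, so the program reduces to optimizing over flows. -/
theorem mem_feasible_iff (M : MDP S Act) (T : Finset S) (wgt : T → ℚ) (p : ProgramPoint Act T) :
    p ∈ M.feasible T wgt ↔ M.IsFlow T p.1 ∧ p = M.ofFlow T wgt p.1 := by
  obtain ⟨x, y, e₁, e₂⟩ := p
  constructor
  · rintro ⟨h1, h2, h3, h4, h5⟩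
    obtain rfl : y = fun q : T => M.inflow T x q := funext h3
    exact ⟨⟨h1, h2⟩, by rw [h4, h5]; rfl⟩
  · rintro ⟨⟨h1, h2⟩, h⟩
    simp only [ofFlow, Prod.mk.injEq, true_and] at h
    obtain ⟨rfl, rfl, rfl⟩ := h
    exact ⟨h1, h2, fun q => rfl, rfl, rfl⟩

theorem inflow_combination (M : MDP S Act) (T : Finset S) (a b : ℝ) (x z : S → Act → ℝ) (s : S) :
    M.inflow T (a • x + b • z) s = a * M.inflow T x s + b * M.inflow T z s := by
  simp only [inflow, Finset.mul_sum, ← Finset.sum_add_distrib]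
  refine Finset.sum_congr rfl fun t _ => Finset.sum_congr rfl fun c _ => ?_
  simp only [Pi.add_apply, Pi.smul_apply, smul_eq_mul]
  ring

theorem ofFlow_combination (M : MDP S Act) (T : Finset S) (wgt : T → ℚ) (a b : ℝ)
    (x z : S → Act → ℝ) :
    M.ofFlow T wgt (a • x + b • z) = a • M.ofFlow T wgt x + b • M.ofFlow T wgt z := by
  simp only [ofFlow, inflow_combination, Prod.smul_mk, Prod.mk_add_mk, Prod.mk.injEq, smul_eq_mul,
    Finset.mul_sum, ← Finset.sum_add_distrib]
  refine ⟨trivial, rfl, ?_, ?_⟩ <;>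
  · refine Finset.sum_congr rfl fun q _ => ?_
    ring

theorem convex_feasible (M : MDP S Act) (T : Finset S) (wgt : T → ℚ) :
    Convex ℝ (M.feasible T wgt) := by
  intro p hp r hr a b ha hb hab
  rw [mem_feasible_iff] at hp hr ⊢
  refine ⟨⟨fun s hs c hc => ?_, fun s hs => ?_⟩, ?_⟩
  · exact add_nonneg (mul_nonneg ha (hp.1.1 s hs c hc)) (mul_nonneg hb (hr.1.1 s hs c hc))
  · rw [Prod.fst_add, Prod.smul_fst, Prod.smul_fst, inflow_combination]
    simp only [Pi.add_apply, Pi.smul_apply, smul_eq_mul, Finset.sum_add_distrib,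
      ← Finset.mul_sum]
    rw [hp.1.2 s hs, hr.1.2 s hs]
    linear_combination (if s = M.init then 1 else 0) * hab
  · rw [Prod.fst_add, Prod.smul_fst, Prod.smul_fst, ofFlow_combination, ← hp.2, ← hr.2]

theorem concaveOn_objective (M : MDP S Act) (T : Finset S) (wgt : T → ℚ) :
    ConcaveOn ℝ (M.feasible T wgt) MDP.objective := by
  refine ⟨M.convex_feasible T wgt, ?_⟩
  rintro ⟨x, y, e₁, e₂⟩ - ⟨x', y', e₁', e₂'⟩ - a b ha hb hab
  simp only [objective, Prod.smul_mk, smul_eq_mul]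
  obtain rfl : b = 1 - a := by linarith
  -- The concavity defect is exactly `a * b * (e₁ - e₁') ^ 2`, as `e₂` enters linearly.
  nlinarith [mul_nonneg (mul_nonneg ha hb) (sq_nonneg (e₁ - e₁'))]

theorem continuous_inflow (M : MDP S Act) (T : Finset S) (s : S) :
    Continuous fun x => M.inflow T x s := by
  unfold inflow
  fun_prop

theorem continuous_objective_ofFlow (M : MDP S Act) (T : Finset S) (wgt : T → ℚ) :
    Continuous fun x => objective (M.ofFlow T wgt x) := by
  have := M.continuous_inflow T
  simp only [objective, ofFlow]
  fun_prop

theorem isClosed_isFlow (M : MDP S Act) (T : Finset S) : IsClosed {x | M.IsFlow T x} := by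
  have := M.continuous_inflow T
  refine IsClosed.and ?_ ?_
  · simp only [Set.ofPred_forall]
    exact isClosed_iInter fun s => isClosed_iInter fun _ => isClosed_iInter fun a =>
      isClosed_iInter fun _ => isClosed_le (by fun_prop) (by fun_prop)
  · simp only [Set.ofPred_forall]
    exact isClosed_iInter fun s => isClosed_iInter fun _ =>
      isClosed_eq (by fun_prop) (by fun_prop)

/-- The action probabilities of a memoryless scheduler that are proportional to a flow. -/
theorem exists_pmf_of_isFlow (M : MDP S Act) {T : Finset S} {x : S → Act → ℝ}
    (hx : ∀ s ∉ T, ∀ a ∈ M.enabled s, 0 ≤ x s a) :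
    ∃ σ : S → PMF Act, (∀ s, ∀ a ∈ (σ s).support, a ∈ M.enabled s) ∧
      ∀ s ∉ T, ∀ a ∈ M.enabled s,
        x s a = (∑ b ∈ M.enabled s, x s b) * (σ s a).toReal := by
  classical
  have key : ∀ s, ∃ p : PMF Act, (∀ a ∈ p.support, a ∈ M.enabled s) ∧
      (s ∉ T → ∀ a ∈ M.enabled s, x s a = (∑ b ∈ M.enabled s, x s b) * (p a).toReal) := by
    intro s
    by_cases h : s ∉ T ∧ 0 < ∑ b ∈ M.enabled s, x s b
    · obtain ⟨hs, hpos⟩ := h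
      let f : Act → ENNReal := fun a =>
        if a ∈ M.enabled s then ENNReal.ofReal (x s a / ∑ b ∈ M.enabled s, x s b) else 0
      have hnn : ∀ a ∈ M.enabled s, 0 ≤ x s a / ∑ b ∈ M.enabled s, x s b := fun a ha =>
        div_nonneg (hx s hs a ha) hpos.le
      have hf : ∑ a ∈ M.enabled s, f a = 1 := by
        rw [Finset.sum_congr rfl fun a ha => if_pos ha, ← ENNReal.ofReal_sum_of_nonneg hnn,
          ← Finset.sum_div, div_self hpos.ne', ENNReal.ofReal_one]
      refine ⟨PMF.ofFinset f (M.enabled s) hf fun a ha => if_neg ha, fun a ha => ?_,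
        fun _ a ha => ?_⟩
      · exact ((PMF.mem_support_ofFinset_iff _ _ _).1 ha).1
      · rw [PMF.ofFinset_apply]
        simp only [f, if_pos ha]
        rw [ENNReal.toReal_ofReal (hnn a ha), mul_div_cancel₀ _ hpos.ne']
    -- In `T`, or where the flow through `s` is zero, any enabled action will do: both sides of the
    -- required equation vanish in the latter case.
    · obtain ⟨a, ha⟩ := M.exists_enabled s
      refine ⟨PMF.pure a, fun b hb => ?_, fun hs b hb => ?_⟩
      · rw [PMF.mem_support_pure_iff] at hb
        exact hb ▸ mem_enabled.2 ha
      · have h0 : ∑ b ∈ M.enabled s, x s b = 0 :=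
          le_antisymm (not_lt.1 fun h' => h ⟨hs, h'⟩) (Finset.sum_nonneg (hx s hs))
        rw [h0, zero_mul]
        exact (Finset.sum_eq_zero_iff_of_nonneg (hx s hs)).1 h0 b hb
  choose σ h1 h2 using key
  exact ⟨σ, h1, h2⟩

/-- The unreachable part of a flow is a circulation: nothing of it gets to `T` or to a reachable
state. -/
theorem mul_prob_eq_zero_of_not_reachable (M : MDP S Act) {T : Finset S} {x : S → Act → ℝ}
    (hx : M.IsFlow T x) {t : S} (ht : t ∉ T) (htR : t ∉ M.reachable) {b : Act}
    (hb : b ∈ M.enabled t) {s : S} (hs : s ∈ T ∨ s ∈ M.reachable) : x t b * M.P t b s = 0 := by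
  classical
  let U : Finset S := Tᶜ.filter (· ∉ M.reachable)
  have hU : ∀ {s}, s ∈ U ↔ s ∉ T ∧ s ∉ M.reachable := by simp [U]
  have hnn : ∀ t ∈ U, ∀ b ∈ M.enabled t, ∀ s, 0 ≤ x t b * M.P t b s := fun t ht b hb s =>
    mul_nonneg (hx.1 t (hU.1 ht).1 b hb) (Rat.cast_nonneg.2 (M.P_nonneg _ _ _))
  -- Neither the source nor a reachable state feeds `U`, so the flow through `U` equals the flow
  -- along edges inside `U`. In `h2` the same flow is split over all successors, hence none is left
  -- for `Uᶜ`.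
  have h1 : ∑ s ∈ U, ∑ a ∈ M.enabled s, x s a =
      ∑ t ∈ U, ∑ b ∈ M.enabled t, ∑ s ∈ U, x t b * M.P t b s := by
    calc ∑ s ∈ U, ∑ a ∈ M.enabled s, x s a
        = ∑ s ∈ U, ∑ t ∈ U, ∑ b ∈ M.enabled t, x t b * M.P t b s := by
          refine Finset.sum_congr rfl fun s hs => ?_
          rw [hx.2 s (hU.1 hs).1, if_neg, add_zero, inflow]
          · refine (Finset.sum_subset (Finset.filter_subset _ _) fun t htT htU => ?_).symm
            have htR : t ∈ M.reachable := by
              by_contra h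
              exact htU (hU.2 ⟨Finset.mem_compl.1 htT, h⟩)
            refine Finset.sum_eq_zero fun b hb => ?_
            by_cases hP : M.P t b s = 0
            · rw [hP, Rat.cast_zero, mul_zero]
            · exact absurd (Relation.ReflTransGen.tail htR ⟨b, hb, hP⟩) (hU.1 hs).2
          · rintro rfl
            exact (hU.1 hs).2 Relation.ReflTransGen.refl
      _ = _ := by
          rw [Finset.sum_comm]
          exact Finset.sum_congr rfl fun t _ => Finset.sum_comm
  have h2 : ∑ s ∈ U, ∑ a ∈ M.enabled s, x s a =
      ∑ t ∈ U, ∑ b ∈ M.enabled t, ∑ s, x t b * M.P t b s := by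
    refine Finset.sum_congr rfl fun t _ => Finset.sum_congr rfl fun b hb => ?_
    have : ∑ s, (M.P t b s : ℝ) = 1 := by exact_mod_cast mem_enabled.1 hb
    rw [← Finset.mul_sum, this, mul_one]
  have h3 : ∑ t ∈ U, ∑ b ∈ M.enabled t, ∑ s ∈ Uᶜ, x t b * M.P t b s = 0 := by
    have h4 : ∀ t b, ∑ s, x t b * (M.P t b s : ℝ) =
        ∑ s ∈ U, x t b * (M.P t b s : ℝ) + ∑ s ∈ Uᶜ, x t b * (M.P t b s : ℝ) := fun t b =>
      (Finset.sum_add_sum_compl U _).symm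
    simp only [h4, Finset.sum_add_distrib] at h2
    linarith
  have htU : t ∈ U := hU.2 ⟨ht, htR⟩
  have h5 := (Finset.sum_eq_zero_iff_of_nonneg fun t ht => Finset.sum_nonneg fun b hb =>
    Finset.sum_nonneg fun s _ => hnn t ht b hb s).1 h3 t htU
  have h6 := (Finset.sum_eq_zero_iff_of_nonneg fun b hb =>
    Finset.sum_nonneg fun s _ => hnn t htU b hb s).1 h5 b hb
  refine (Finset.sum_eq_zero_iff_of_nonneg fun s _ => hnn t htU b hb s).1 h6 s ?_
  rw [Finset.mem_compl, hU]
  tauto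

/-- A source-free flow on the reachable states whose entries at each state have a common sign
vanishes, if there is a potential that decreases by at least one in expectation in each step. -/
theorem eq_zero_of_flow (M : MDP S Act) {T : Finset S} {L : S → ℝ} (hL0 : ∀ s, 0 ≤ L s)
    (hL : ∀ s ∈ M.reachable, s ∉ T → ∀ a ∈ M.enabled s, ∑ t, (M.P s a t : ℝ) * L t + 1 ≤ L s)
    {z : S → Act → ℝ} (hzR : ∀ s ∉ M.reachable, ∀ a, z s a = 0)
    (hsign : ∀ s ∉ T, ∑ a ∈ M.enabled s, |z s a| = |∑ a ∈ M.enabled s, z s a|)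
    (hz : ∀ s ∉ T, ∑ a ∈ M.enabled s, z s a = M.inflow T z s) :
    ∀ s ∉ T, ∀ a ∈ M.enabled s, z s a = 0 := by
  have hPnn : ∀ s a t, (0 : ℝ) ≤ M.P s a t := fun s a t => Rat.cast_nonneg.2 (M.P_nonneg _ _ _)
  -- Weigh `|z|` by `L`. Thanks to the common sign, the absolute outflow of a state is the absolute
  -- value of its inflow, at most the inflow of `|z|`. One transition costs at least the total mass
  -- of `|z|` in potential, so that mass is zero.
  have h1 : ∑ s ∈ Tᶜ, ∑ a ∈ M.enabled s, |z s a| * L s ≤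
      ∑ t ∈ Tᶜ, ∑ b ∈ M.enabled t, |z t b| * ∑ s ∈ Tᶜ, M.P t b s * L s := by
    calc ∑ s ∈ Tᶜ, ∑ a ∈ M.enabled s, |z s a| * L s
        ≤ ∑ s ∈ Tᶜ, ∑ t ∈ Tᶜ, ∑ b ∈ M.enabled t, |z t b| * M.P t b s * L s := by
          refine Finset.sum_le_sum fun s hs => ?_
          have hs' := Finset.mem_compl.1 hs
          simp_rw [← Finset.sum_mul]
          refine mul_le_mul_of_nonneg_right ?_ (hL0 s)
          rw [hsign s hs', hz s hs', inflow]
          refine (Finset.abs_sum_le_sum_abs _ _).trans (Finset.sum_le_sum fun t _ => ?_)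
          refine (Finset.abs_sum_le_sum_abs _ _).trans (Finset.sum_le_sum fun b _ => ?_)
          rw [abs_mul, abs_of_nonneg (hPnn t b s)]
      _ = _ := by
          rw [Finset.sum_comm]
          refine Finset.sum_congr rfl fun t _ => ?_
          rw [Finset.sum_comm]
          refine Finset.sum_congr rfl fun b _ => ?_
          rw [Finset.mul_sum]
          exact Finset.sum_congr rfl fun s _ => mul_assoc _ _ _
  have h2 : ∑ t ∈ Tᶜ, ∑ b ∈ M.enabled t, |z t b| * ∑ s ∈ Tᶜ, M.P t b s * L s ≤
      ∑ t ∈ Tᶜ, ∑ b ∈ M.enabled t, (|z t b| * L t - |z t b|) := by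
    refine Finset.sum_le_sum fun t ht => Finset.sum_le_sum fun b hb => ?_
    by_cases htR : t ∈ M.reachable
    · have h3 := hL t htR (Finset.mem_compl.1 ht) b hb
      have h4 : ∑ s ∈ Tᶜ, (M.P t b s : ℝ) * L s ≤ ∑ s, (M.P t b s : ℝ) * L s :=
        Finset.sum_le_sum_of_subset_of_nonneg (Finset.subset_univ _)
          fun s _ _ => mul_nonneg (hPnn t b s) (hL0 s)
      nlinarith [abs_nonneg (z t b)]
    · simp [hzR t htR b]
  simp only [Finset.sum_sub_distrib] at h2
  have h3 : ∑ t ∈ Tᶜ, ∑ b ∈ M.enabled t, |z t b| = 0 :=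
    le_antisymm (by linarith) (Finset.sum_nonneg fun _ _ => Finset.sum_nonneg fun _ _ =>
      abs_nonneg _)
  intro s hs a ha
  have h4 := (Finset.sum_eq_zero_iff_of_nonneg fun t _ => Finset.sum_nonneg fun b _ =>
    abs_nonneg (z t b)).1 h3 s (Finset.mem_compl.2 hs)
  exact abs_eq_zero.1 ((Finset.sum_eq_zero_iff_of_nonneg fun b _ => abs_nonneg (z s b)).1 h4 a ha)

end Flow

end MDP

/-! ### Expected visits and the correspondence with schedulers -/

namespace MDP

open Filter Topology

section Expected

variable {S Act : Type*} [Fintype S] [Fintype Act] [DecidableEq S]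
  [MeasurableSpace S] [MeasurableSingletonClass S]
  [MeasurableSpace Act] [MeasurableSingletonClass Act]

theorem occ_succ_of_notMem (M : MDP S Act) (𝔖 : M.Scheduler) {T : Finset S}
    (hT : ∀ t ∈ T, M.IsAbsorbing t) (n : ℕ) {s : S} (hs : s ∉ T) :
    M.occ 𝔖 (n + 1) s = M.inflow T (M.visit 𝔖 n) s := by
  rw [occ_succ, inflow]
  refine (Finset.sum_subset (Finset.subset_univ _) fun t _ ht => ?_).symm
  have htT : t ∈ T := by simpa using ht
  refine Finset.sum_eq_zero fun a ha => ?_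
  rw [prob_eq_zero_of_isAbsorbing (hT t htT) ha (show s ≠ t from fun h => hs (h ▸ htT)), Rat.cast_zero, mul_zero]

theorem occ_succ_of_mem (M : MDP S Act) (𝔖 : M.Scheduler) {T : Finset S}
    (hT : ∀ t ∈ T, M.IsAbsorbing t) (n : ℕ) {q : S} (hq : q ∈ T) :
    M.occ 𝔖 (n + 1) q = M.inflow T (M.visit 𝔖 n) q + M.occ 𝔖 n q := by
  rw [occ_succ, inflow, ← Finset.sum_add_sum_compl Tᶜ, compl_compl]
  congr 1
  rw [Finset.sum_eq_single_of_mem q hq, ← sum_visit]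
  · refine Finset.sum_congr rfl fun a ha => ?_
    rw [hT q hq a ha, Rat.cast_one, mul_one]
  · intro t htT htq
    refine Finset.sum_eq_zero fun a ha => ?_
    rw [prob_eq_zero_of_isAbsorbing (hT t htT) ha htq.symm, Rat.cast_zero, mul_zero]

/-- The expected number of steps outside `T` is bounded by the potential of the initial state. -/
theorem sum_occ_le_potential (M : MDP S Act) (𝔖 : M.Scheduler) {T : Finset S}
    (hT : ∀ t ∈ T, M.IsAbsorbing t) {L : S → ℝ} (hL0 : ∀ s, 0 ≤ L s)
    (hL : ∀ s ∈ M.reachable, s ∉ T → ∀ a ∈ M.enabled s, ∑ t, (M.P s a t : ℝ) * L t + 1 ≤ L s)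
    (n : ℕ) : ∑ k ∈ Finset.range n, ∑ s ∈ Tᶜ, M.occ 𝔖 k s ≤ L M.init := by
  have hPnn : ∀ s a t, (0 : ℝ) ≤ M.P s a t := fun s a t => Rat.cast_nonneg.2 (M.P_nonneg _ _ _)
  have hstep : ∀ k, ∑ s ∈ Tᶜ, M.occ 𝔖 (k + 1) s * L s ≤
      ∑ s ∈ Tᶜ, M.occ 𝔖 k s * L s - ∑ s ∈ Tᶜ, M.occ 𝔖 k s := by
    intro k
    calc ∑ s ∈ Tᶜ, M.occ 𝔖 (k + 1) s * L s
        = ∑ s ∈ Tᶜ, ∑ t ∈ Tᶜ, ∑ b ∈ M.enabled t, M.visit 𝔖 k t b * (M.P t b s * L s) := by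
          refine Finset.sum_congr rfl fun s hs => ?_
          rw [occ_succ_of_notMem M 𝔖 hT k (Finset.mem_compl.1 hs), inflow, Finset.sum_mul]
          simp_rw [Finset.sum_mul, mul_assoc]
      _ = ∑ t ∈ Tᶜ, ∑ b ∈ M.enabled t, M.visit 𝔖 k t b * ∑ s ∈ Tᶜ, M.P t b s * L s := by
          rw [Finset.sum_comm]
          refine Finset.sum_congr rfl fun t _ => ?_
          rw [Finset.sum_comm]
          simp_rw [Finset.mul_sum]
      _ ≤ ∑ t ∈ Tᶜ, ∑ b ∈ M.enabled t, (M.visit 𝔖 k t b * L t - M.visit 𝔖 k t b) := by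
          refine Finset.sum_le_sum fun t ht => Finset.sum_le_sum fun b hb => ?_
          by_cases htR : t ∈ M.reachable
          · have h3 := hL t htR (Finset.mem_compl.1 ht) b hb
            have h4 : ∑ s ∈ Tᶜ, (M.P t b s : ℝ) * L s ≤ ∑ s, (M.P t b s : ℝ) * L s :=
              Finset.sum_le_sum_of_subset_of_nonneg (Finset.subset_univ _)
                fun s _ _ => mul_nonneg (hPnn t b s) (hL0 s)
            nlinarith [visit_nonneg M 𝔖 k t b]
          · simp [visit_eq_zero_of_occ M 𝔖 (occ_eq_zero_of_not_reachable M 𝔖 k htR) b]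
      _ = _ := by
          simp_rw [Finset.sum_sub_distrib, ← Finset.sum_mul, sum_visit]
  -- Telescoping of `hstep`: the potential spent plus what is left never exceeds the initial
  -- potential.
  have hsum : ∀ m, ∑ k ∈ Finset.range m, ∑ s ∈ Tᶜ, M.occ 𝔖 k s
      + ∑ s ∈ Tᶜ, M.occ 𝔖 m s * L s ≤ ∑ s ∈ Tᶜ, M.occ 𝔖 0 s * L s := by
    intro m
    induction m with
    | zero => simp
    | succ m ih =>
      rw [Finset.sum_range_succ]
      linarith [hstep m]
  have h0 : ∑ s ∈ Tᶜ, M.occ 𝔖 0 s * L s ≤ L M.init := by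
    refine (Finset.sum_le_sum_of_subset_of_nonneg (Finset.subset_univ _)
      fun s _ _ => mul_nonneg (occ_nonneg M 𝔖 0 s) (hL0 s)).trans ?_
    simp [occ_zero]
  have h1 : 0 ≤ ∑ s ∈ Tᶜ, M.occ 𝔖 n s * L s :=
    Finset.sum_nonneg fun s _ => mul_nonneg (occ_nonneg M 𝔖 n s) (hL0 s)
  linarith [hsum n]

/-- The expected numbers of visits to the state-action pairs outside `T`. -/
noncomputable def expectedVisits (M : MDP S Act) (T : Finset S) (𝔖 : M.Scheduler) (s : S)
    (a : Act) : ℝ :=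
  if s ∈ T then 0 else ∑' n, M.visit 𝔖 n s a

variable (M : MDP S Act) (𝔖 : M.Scheduler) {T : Finset S}
  (hT : ∀ t ∈ T, M.IsAbsorbing t) {L : S → ℝ} (hL0 : ∀ s, 0 ≤ L s)
  (hL : ∀ s ∈ M.reachable, s ∉ T → ∀ a ∈ M.enabled s, ∑ t, (M.P s a t : ℝ) * L t + 1 ≤ L s)

include hT hL0 hL

theorem sum_range_visit_le {s : S} (hs : s ∉ T) (a : Act) (n : ℕ) :
    ∑ k ∈ Finset.range n, M.visit 𝔖 k s a ≤ L M.init := by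
  refine (Finset.sum_le_sum fun k _ => ?_).trans (sum_occ_le_potential M 𝔖 hT hL0 hL n)
  exact (visit_le_occ M 𝔖 k s a).trans
    (Finset.single_le_sum (fun s _ => occ_nonneg M 𝔖 k s) (Finset.mem_compl.2 hs))

theorem hasSum_visit {s : S} (hs : s ∉ T) (a : Act) :
    HasSum (fun n => M.visit 𝔖 n s a) (M.expectedVisits T 𝔖 s a) := by
  rw [expectedVisits, if_neg hs]
  exact (summable_of_sum_range_le (fun n => visit_nonneg M 𝔖 n s a)
    (sum_range_visit_le M 𝔖 hT hL0 hL hs a)).hasSum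

theorem expectedVisits_mem_Icc :
    M.expectedVisits T 𝔖 ∈ Set.Icc (fun _ _ => 0) (fun (_ : S) (_ : Act) => L M.init) := by
  refine ⟨fun s a => ?_, fun s a => ?_⟩
  · unfold expectedVisits
    split_ifs
    · exact le_rfl
    · exact tsum_nonneg fun n => visit_nonneg M 𝔖 n s a
  · unfold expectedVisits
    split_ifs with hs
    · exact hL0 _
    · exact Real.tsum_le_of_sum_range_le (fun n => visit_nonneg M 𝔖 n s a)
        (sum_range_visit_le M 𝔖 hT hL0 hL hs a)

theorem hasSum_inflow_visit (s : S) :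
    HasSum (fun n => M.inflow T (M.visit 𝔖 n) s) (M.inflow T (M.expectedVisits T 𝔖) s) :=
  hasSum_sum fun _ ht => hasSum_sum fun b _ =>
    (hasSum_visit M 𝔖 hT hL0 hL (Finset.mem_compl.1 ht) b).mul_right _

theorem hasSum_occ {s : S} (hs : s ∉ T) :
    HasSum (fun n => M.occ 𝔖 n s) (∑ a ∈ M.enabled s, M.expectedVisits T 𝔖 s a) := by
  simp_rw [← sum_visit]
  exact hasSum_sum fun a _ => hasSum_visit M 𝔖 hT hL0 hL hs a

/-- Summing `occ_succ_of_notMem` over time gives the occupation series without its term at time `0`;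
that term is the source. -/
theorem isFlow_expectedVisits : M.IsFlow T (M.expectedVisits T 𝔖) := by
  refine ⟨fun s _ a _ => (expectedVisits_mem_Icc M 𝔖 hT hL0 hL).1 s a, fun s hs => ?_⟩
  have h := hasSum_inflow_visit M 𝔖 hT hL0 hL s
  simp_rw [← occ_succ_of_notMem M 𝔖 hT _ hs] at h
  have h' := (hasSum_nat_add_iff (f := fun n => M.occ 𝔖 n s) 1).1 h
  rw [(hasSum_occ M 𝔖 hT hL0 hL hs).unique h', Finset.sum_range_one, occ_zero]

theorem tendsto_occ_of_mem {q : S} (hq : q ∈ T) :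
    Tendsto (fun n => M.occ 𝔖 n q) atTop
      (𝓝 (M.inflow T (M.expectedVisits T 𝔖) q + M.occ 𝔖 0 q)) := by
  have h := ((hasSum_inflow_visit M 𝔖 hT hL0 hL q).tendsto_sum_nat).add_const (M.occ 𝔖 0 q)
  refine h.congr fun n => ?_
  induction n with
  | zero => simp
  | succ n ih => rw [Finset.sum_range_succ, occ_succ_of_mem M 𝔖 hT n hq, ← ih]; ring

theorem integral_WR_pow (hreach : ∀ᵐ ω ∂(M.pathMeasure 𝔖 M.init), ∃ n, ω.1 n ∈ T)
    (wgt : T → ℚ) (j : ℕ) : ∫ ω, WR T wgt ω ^ j ∂(M.pathMeasure 𝔖 M.init) =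
      ∑ q : T, (M.inflow T (M.expectedVisits T 𝔖) q + M.occ 𝔖 0 q) * (wgt q : ℝ) ^ j :=
  tendsto_nhds_unique (tendsto_sum_occ M 𝔖 hT hreach wgt j) <|
    tendsto_finsetSum _ fun q _ => (tendsto_occ_of_mem M 𝔖 hT hL0 hL q.2).mul_const _

omit hL0 hL in
theorem occ_eq_zero_of_init_mem (hinit : M.init ∈ T) (n : ℕ) {s : S} (hs : s ∉ T) :
    M.occ 𝔖 n s = 0 := by
  induction n generalizing s with
  | zero => rw [occ_zero, if_neg]; rintro rfl; exact hs hinit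
  | succ n ih =>
    rw [occ_succ_of_notMem M 𝔖 hT n hs, inflow]
    refine Finset.sum_eq_zero fun t ht => Finset.sum_eq_zero fun b _ => ?_
    rw [visit_eq_zero_of_occ M 𝔖 (ih (Finset.mem_compl.1 ht)), zero_mul]

/-- The moments contain the mass that is in `T` at time `0`, which the program ignores. If the
initial state is in `T`, all inflows vanish and the objective is zero, as is the variance of the
then almost surely constant `WR`. -/
theorem variance_WR_eq_objective (hreach : ∀ᵐ ω ∂(M.pathMeasure 𝔖 M.init), ∃ n, ω.1 n ∈ T)
    (wgt : T → ℚ) : variance (WR T wgt) (M.pathMeasure 𝔖 M.init) =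
      objective (M.ofFlow T wgt (M.expectedVisits T 𝔖)) := by
  rw [variance_WR M 𝔖 hT hreach wgt, integral_WR_pow M 𝔖 hT hL0 hL hreach,
    integral_WR_pow M 𝔖 hT hL0 hL hreach]
  simp only [objective, ofFlow, pow_one]
  by_cases hinit : M.init ∈ T
  · have h0 : ∀ q, M.inflow T (M.expectedVisits T 𝔖) q = 0 := by
      intro q
      have h := hasSum_inflow_visit M 𝔖 hT hL0 hL q
      refine h.unique ?_
      convert hasSum_zero (α := ℝ) (β := ℕ) using 2 with n
      refine Finset.sum_eq_zero fun t ht => Finset.sum_eq_zero fun b _ => ?_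
      rw [visit_eq_zero_of_occ M 𝔖
        (occ_eq_zero_of_init_mem M 𝔖 hT hinit n (Finset.mem_compl.1 ht)), zero_mul]
    have h1 : ∀ g : T → ℝ, ∑ q : T, M.occ 𝔖 0 q * g q = g ⟨M.init, hinit⟩ := by
      intro g
      rw [Finset.sum_eq_single_of_mem ⟨M.init, hinit⟩ (Finset.mem_univ _)]
      · simp [occ_zero]
      · intro q _ hq
        rw [occ_zero, if_neg fun h => hq (Subtype.ext h), zero_mul]
    simp only [h0, zero_add, h1]
    simp
  · have h1 : ∀ q : T, M.occ 𝔖 0 q = 0 := fun q => by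
      rw [occ_zero, if_neg]
      exact fun h => hinit (h ▸ q.2)
    simp [h1]

/-- Every flow has the same inflow to `T` as the expected visits of some memoryless scheduler. -/
theorem exists_scheduler_of_isFlow {x : S → Act → ℝ} (hx : M.IsFlow T x) :
    ∃ 𝔗 : M.Scheduler, ∀ q ∈ T, M.inflow T x q = M.inflow T (M.expectedVisits T 𝔗) q := by
  classical
  obtain ⟨σ, hσ, hxσ⟩ := M.exists_pmf_of_isFlow hx.1
  let 𝔗 := M.memoryless σ hσ
  refine ⟨𝔗, fun q hq => ?_⟩
  have hvR : ∀ s ∉ M.reachable, ∀ a, M.expectedVisits T 𝔗 s a = 0 := by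
    intro s hs a
    simp [expectedVisits, visit_eq_zero_of_occ M 𝔗 (occ_eq_zero_of_not_reachable M 𝔗 _ hs)]
  -- The expected visits split among the actions in the proportions `σ s`, just as `x` does. Hence
  -- the difference `z` is a multiple of `σ s` at each reachable state outside `T`, which gives the
  -- common sign.
  have hvσ : ∀ s ∉ T, ∀ a, M.expectedVisits T 𝔗 s a
      = (∑ b ∈ M.enabled s, M.expectedVisits T 𝔗 s b) * (σ s a).toReal := by
    intro s hs a
    refine (hasSum_visit M 𝔗 hT hL0 hL hs a).unique ?_
    simp_rw [𝔗, visit_memoryless]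
    exact (hasSum_occ M 𝔗 hT hL0 hL hs).mul_right _
  have hv := isFlow_expectedVisits M 𝔗 hT hL0 hL
  -- Cutting off the unreachable states removes a possible circulation of `x`, without changing
  -- inflows to `T` or to reachable states.
  let z : S → Act → ℝ := fun s a =>
    if s ∈ M.reachable then x s a - M.expectedVisits T 𝔗 s a else 0
  have hzin : ∀ s, s ∈ T ∨ s ∈ M.reachable →
      M.inflow T z s = M.inflow T x s - M.inflow T (M.expectedVisits T 𝔗) s := by
    intro s hs
    simp only [inflow, ← Finset.sum_sub_distrib]
    refine Finset.sum_congr rfl fun t ht => Finset.sum_congr rfl fun b hb => ?_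
    by_cases htR : t ∈ M.reachable
    · simp only [z, if_pos htR]; ring
    · rw [M.mul_prob_eq_zero_of_not_reachable hx (Finset.mem_compl.1 ht) htR hb hs, hvR t htR]
      simp [z, htR]
  have hz : ∀ s ∉ T, ∀ a ∈ M.enabled s, z s a = 0 := by
    refine M.eq_zero_of_flow hL0 hL (fun s hs a => if_neg hs) (fun s hs => ?_) fun s hs => ?_
    · by_cases hsR : s ∈ M.reachable
      · have hzs : ∀ a ∈ M.enabled s, z s a = (∑ b ∈ M.enabled s, x s b
            - ∑ b ∈ M.enabled s, M.expectedVisits T 𝔗 s b) * (σ s a).toReal := by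
          intro a ha
          simp only [z, if_pos hsR]
          rw [hxσ s hs a ha, hvσ s hs a, sub_mul]
        rw [Finset.sum_congr rfl hzs, Finset.sum_congr rfl fun a ha => congrArg abs (hzs a ha),
          ← Finset.mul_sum, abs_mul,
          abs_of_nonneg (Finset.sum_nonneg fun a _ => ENNReal.toReal_nonneg), Finset.mul_sum]
        exact Finset.sum_congr rfl fun a _ => by rw [abs_mul, abs_of_nonneg ENNReal.toReal_nonneg]
      · simp [z, hsR]
    · by_cases hsR : s ∈ M.reachable
      · rw [hzin s (Or.inr hsR)]
        simp only [z, if_pos hsR, Finset.sum_sub_distrib]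
        rw [hx.2 s hs, hv.2 s hs]
        ring
      · simp only [z, if_neg hsR, Finset.sum_const_zero]
        refine (Finset.sum_eq_zero fun t _ => Finset.sum_eq_zero fun b hb => ?_).symm
        by_cases htR : t ∈ M.reachable
        · by_cases hP : M.P t b s = 0
          · rw [hP, Rat.cast_zero, mul_zero]
          · exact absurd (Relation.ReflTransGen.tail htR ⟨b, hb, hP⟩) hsR
        · simp only [if_neg htR, zero_mul]
  have h0 : M.inflow T z q = 0 :=
    Finset.sum_eq_zero fun t ht => Finset.sum_eq_zero fun b hb => by
      rw [hz t (Finset.mem_compl.1 ht) b hb, zero_mul]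
  rw [hzin q (Or.inl hq)] at h0
  linarith

end Expected

end MDP

/-! ### The main theorem -/

theorem mainTheorem6 {S Act : Type*} [Fintype S] [DecidableEq S] [Fintype Act]
    [MeasurableSpace S] [MeasurableSingletonClass S]
    [MeasurableSpace Act] [MeasurableSingletonClass Act]
    (M : MDP S Act) (T : Finset S) (hT : ∀ t ∈ T, M.IsAbsorbing t) (wgt : T → ℚ)
    (hreach : ∀ 𝔖 : M.Scheduler, ∀ᵐ ω ∂(M.pathMeasure 𝔖 M.init), ∃ n, ω.1 n ∈ T) :
    ConcaveOn ℝ (M.feasible T wgt) MDP.objective ∧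
    BddAbove (Set.range fun 𝔖 : M.Scheduler => variance (WR T wgt) (M.pathMeasure 𝔖 M.init)) ∧
    IsGreatest (MDP.objective '' M.feasible T wgt) (M.maxVariance (WR T wgt)) := by
  obtain ⟨W, L, hTW, hL0, hLW, hW⟩ := M.exists_potential T
  have hRW := M.reachable_subset_of_ae_reach hT hreach hTW hW
  have hL : ∀ s ∈ M.reachable, s ∉ T → ∀ a ∈ M.enabled s,
      ∑ t, (M.P s a t : ℝ) * L t + 1 ≤ L s := fun s hs => hLW s (hRW hs)
  have hvar : ∀ 𝔖 : M.Scheduler, variance (WR T wgt) (M.pathMeasure 𝔖 M.init) =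
      MDP.objective (M.ofFlow T wgt (M.expectedVisits T 𝔖)) := fun 𝔖 =>
    MDP.variance_WR_eq_objective M 𝔖 hT hL0 hL (hreach 𝔖) wgt
  have hflow : ∀ x, M.IsFlow T x → ∃ 𝔖 : M.Scheduler,
      MDP.objective (M.ofFlow T wgt x) = variance (WR T wgt) (M.pathMeasure 𝔖 M.init) := by
    intro x hx
    obtain ⟨𝔖, h𝔖⟩ := MDP.exists_scheduler_of_isFlow M hT hL0 hL hx
    refine ⟨𝔖, ?_⟩
    rw [hvar]
    simp only [MDP.objective, MDP.ofFlow]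
    simp_rw [h𝔖 _ (Subtype.coe_prop _)]
  -- The set of flows itself need not be compact: disabled coordinates are free and unreachable
  -- circulations can be scaled. The box makes it compact and still contains all expected visits.
  let K : Set (S → Act → ℝ) :=
    Set.Icc (fun _ _ => 0) (fun _ _ => L M.init) ∩ {x | M.IsFlow T x}
  have hK : ∀ 𝔖 : M.Scheduler, M.expectedVisits T 𝔖 ∈ K := fun 𝔖 =>
    ⟨MDP.expectedVisits_mem_Icc M 𝔖 hT hL0 hL, MDP.isFlow_expectedVisits M 𝔖 hT hL0 hL⟩
  obtain ⟨𝔖₀⟩ : Nonempty M.Scheduler := by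
    choose a ha using M.exists_enabled
    refine ⟨M.memoryless (fun s => PMF.pure (a s)) fun s b hb => ?_⟩
    rw [PMF.mem_support_pure_iff] at hb
    exact hb ▸ MDP.mem_enabled.2 (ha s)
  obtain ⟨x, hx, hmax⟩ := (isCompact_Icc.inter_right (M.isClosed_isFlow T)).exists_isMaxOn
    ⟨_, hK 𝔖₀⟩ (M.continuous_objective_ofFlow T wgt).continuousOn
  have hle : ∀ 𝔖 : M.Scheduler, variance (WR T wgt) (M.pathMeasure 𝔖 M.init) ≤
      MDP.objective (M.ofFlow T wgt x) := fun 𝔖 => by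
    rw [hvar]
    exact hmax (hK 𝔖)
  have hbdd : BddAbove (Set.range fun 𝔖 : M.Scheduler =>
      variance (WR T wgt) (M.pathMeasure 𝔖 M.init)) :=
    ⟨_, Set.forall_mem_range.2 hle⟩
  have hxflow : M.IsFlow T x := hx.2
  -- The maximizer over `K` is realized by a scheduler, so the supremum of the variances is
  -- attained. Flows outside `K` are covered too, since each has the value of some scheduler.
  obtain ⟨𝔗, h𝔗⟩ := hflow x hxflow
  have hsup : M.maxVariance (WR T wgt) = MDP.objective (M.ofFlow T wgt x) :=
    have : Nonempty M.Scheduler := ⟨𝔖₀⟩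
    le_antisymm (ciSup_le hle) (h𝔗.le.trans (le_ciSup hbdd 𝔗))
  refine ⟨M.concaveOn_objective T wgt, hbdd, ?_, ?_⟩
  · exact ⟨_, (M.mem_feasible_iff T wgt _).2 ⟨hxflow, rfl⟩, hsup.symm⟩
  · rintro _ ⟨p, hp, rfl⟩
    rw [MDP.mem_feasible_iff] at hp
    obtain ⟨𝔖, h𝔖⟩ := hflow p.1 hp.1
    rw [hp.2, h𝔖, hsup]
    exact hle 𝔖
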